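/- Let $F\in\mathbb{C}[y,p]$ be a nonzero polynomial and consider the autonomous differential equation $F(y,y')=0$, where $'=d/dx$. A formal Puiseux series expanded around $x_0\in\mathbb{C}$ is a formal series $y(x)=\sum_{j\ge j_0}a_j\,(x-x_0)^{j/n}$, and a formal Puiseux series expanded at infinity is a formal series $y(x)=\sum_{j\ge j_0}a_j\,x^{-j/n}$, with $n\in\mathbb{Z}_{>0}$, $j_0\in\mathbb{Z}$ and $a_j\in\mathbb{C}$; it is differentiated term by term, and it is a solution if $F(y,y')=0$ holds as an identity of formal Puiseux series. Then every formal Puiseux series solution of $F(y,y')=0$ is convergent: 1. If $y(x)=\sum_{j\ge j_0}a_j(x-x_0)^{j/n}$ is a formal solution expanded around a finite point $x_0\in\mathbb{C}$, then there is $r>0$ such that the series $\sum_{j\ge j_0}a_j(x-x_0)^{j/n}$ converges absolutely for all $x\in\mathbb{C}$ with $0<|x-x_0|<r$. 2. If $y(x)=\sum_{j\ge j_0}a_jx^{-j/n}$ is a formal solution expanded at infinity, then there is $R>0$ such that the series $\sum_{j\ge j_0}a_jx^{-j/n}$ converges absolutely for all $x\in\mathbb{C}$ with $|x|>R$. -/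

import Mathlib

/-- A generalized power series `∑ a_q z^q` with rational exponents and complex coefficients is a
formal Puiseux series if all its exponents lie in `(1/n)ℤ` for some positive integer `n`.
(The exponents are bounded below when `n` exists, since the support of a Hahn series is
well-ordered; so this is the union of the fields `ℂ((z^{1/n}))`, `n ≥ 1`.) -/
def IsPuiseux (φ : HahnSeries ℚ ℂ) : Prop :=
  ∃ n : ℕ, 0 < n ∧ ∀ q : ℚ, φ.coeff q ≠ 0 → ∃ j : ℤ, q = (j : ℚ) / (n : ℚ)

/-- Formal derivative with respect to `x` of `∑ a_q (x - x₀)^q`, namely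
`∑ q a_q (x - x₀)^(q-1)`, as a series in the local parameter `x - x₀`. -/
noncomputable def derivFinite (φ : HahnSeries ℚ ℂ) : HahnSeries ℚ ℂ where
  coeff q := ((q + 1 : ℚ) : ℂ) * φ.coeff (q + 1)
  isPWO_support' := by
    refine (φ.isPWO_support.image_of_monotone (f := fun q : ℚ => q - 1)
      (fun a b h => sub_le_sub_right h 1)).mono ?_
    intro q hq
    exact ⟨q + 1, right_ne_zero_of_mul hq, add_sub_cancel_right q 1⟩

/-- Formal derivative with respect to `x` of `∑ a_q x^(-q)`, namely `∑ (-q) a_q x^(-(q+1))`,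
as a series in the local parameter `1/x`. -/
noncomputable def derivInfinity (φ : HahnSeries ℚ ℂ) : HahnSeries ℚ ℂ where
  coeff q := -((q - 1 : ℚ) : ℂ) * φ.coeff (q - 1)
  isPWO_support' := by
    refine (φ.isPWO_support.image_of_monotone (f := fun q : ℚ => q + 1)
      (fun a b h => add_le_add_left h 1)).mono ?_
    intro q hq
    exact ⟨q - 1, right_ne_zero_of_mul hq, sub_add_cancel q 1⟩

/-- `y(x) = ∑ a_q (x - x₀)^q` is a formal solution of `F(y, y') = 0`; the variables of `F` are
`y = X 0` and `p = X 1`. As the equation is autonomous, `x₀` does not enter the condition. -/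
def IsFormalSolutionFinite (F : MvPolynomial (Fin 2) ℂ) (φ : HahnSeries ℚ ℂ) : Prop :=
  MvPolynomial.aeval ![φ, derivFinite φ] F = 0

/-- `y(x) = ∑ a_q x^(-q)` is a formal solution of `F(y, y') = 0`. -/
def IsFormalSolutionInfinity (F : MvPolynomial (Fin 2) ℂ) (φ : HahnSeries ℚ ℂ) : Prop :=
  MvPolynomial.aeval ![φ, derivInfinity φ] F = 0

/-- The series `∑ a_q (x - x₀)^q` converges in a punctured disc around `x₀`. (Summability in `ℂ` is
absolute and `|w^q| = |w|^q` for `w ≠ 0` and `q` rational, so the branch of the power is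
immaterial.) -/
def ConvergesAt (x₀ : ℂ) (φ : HahnSeries ℚ ℂ) : Prop :=
  ∃ r : ℝ, 0 < r ∧ ∀ x : ℂ, 0 < ‖x - x₀‖ → ‖x - x₀‖ < r →
    Summable fun q : ℚ => φ.coeff q * (x - x₀) ^ (q : ℂ)

/-- The series `∑ a_q x^(-q)` converges in a punctured neighbourhood of infinity. -/
def ConvergesAtInfinity (φ : HahnSeries ℚ ℂ) : Prop :=
  ∃ R : ℝ, 0 < R ∧ ∀ x : ℂ, R < ‖x‖ → Summable fun q : ℚ => φ.coeff q * x ^ (-(q : ℂ))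

/-! Let `x` also denote the local coordinate `x - x₀`, and put `x = X ^ N`, with `N = n` at a finite
point and `N = -n` at infinity. A solution becomes a Laurent series `f` in `X`, algebraically
dependent on `p = df/dx`. If `f` is not constant, `f = c + S ^ m` with `S = X U` a uniformizer. Now
take `S` as the variable: `x = S ^ N u(S)`, so `dx/dS = S ^ (N-1) W(S)` with `W = N u + X u'`, and
`m S ^ (m-1) = p * dx/dS`. Since `p` is algebraic over `ℂ[f]`, `W` is algebraic over the
polynomials, hence convergent; so are then `u`, `U` and `f`
(`isConvergentLaurent_of_not_algebraicIndependent`).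

Algebraic series converge (`mem_convergentSeries_of_isAlgebraic`) because a Hensel-type shift turns
the equation into `v = a + X E`, with `E` controlled by `v`. Truncated norms of `v` then stay
bounded by induction on the length (`mem_convergentSeries_of_dominated`). The same fixed-point
argument handles compositional inverses. -/

open Finset PowerSeries

/-! ### Truncated weighted norms -/

/-- The weighted `ℓ¹` norm `∑ ‖f_j‖ ρ^j` of the truncation of `f` to exponents `j < M`. -/
noncomputable def truncNorm (ρ : ℝ) (M : ℕ) (f : ℂ⟦X⟧) : ℝ :=
  ∑ j ∈ range M, ‖coeff j f‖ * ρ ^ j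

section TruncNorm

variable {ρ : ℝ} {M : ℕ} {f g : ℂ⟦X⟧}

theorem truncNorm_nonneg (hρ : 0 ≤ ρ) : 0 ≤ truncNorm ρ M f :=
  sum_nonneg fun _ _ => by positivity

theorem truncNorm_add_le (hρ : 0 ≤ ρ) :
    truncNorm ρ M (f + g) ≤ truncNorm ρ M f + truncNorm ρ M g := by
  unfold truncNorm
  rw [← sum_add_distrib]
  refine sum_le_sum fun j _ => ?_
  rw [map_add, ← add_mul]
  gcongr
  exact norm_add_le _ _

theorem truncNorm_mul_le (hρ : 0 ≤ ρ) :
    truncNorm ρ M (f * g) ≤ truncNorm ρ M f * truncNorm ρ M g := by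
  let h : ℕ × ℕ → ℝ := fun p => (‖coeff p.1 f‖ * ρ ^ p.1) * (‖coeff p.2 g‖ * ρ ^ p.2)
  have hh : ∀ p, 0 ≤ h p := fun p => by positivity
  let s := (range M ×ˢ range M).filter fun p => p.1 + p.2 < M
  calc truncNorm ρ M (f * g) ≤ ∑ n ∈ range M, ∑ p ∈ antidiagonal n, h p := by
        refine sum_le_sum fun n _ => ?_
        rw [coeff_mul]
        refine (mul_le_mul_of_nonneg_right (norm_sum_le _ _) (by positivity)).trans ?_
        rw [sum_mul]
        refine sum_le_sum fun p hp => le_of_eq ?_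
        rw [← HasAntidiagonal.mem_antidiagonal.mp hp, norm_mul, pow_add]
        ring
    _ = ∑ n ∈ range M, ∑ p ∈ s with p.1 + p.2 = n, h p := by
        refine sum_congr rfl fun n hn => sum_congr ?_ fun _ _ => rfl
        ext p
        simp only [s, HasAntidiagonal.mem_antidiagonal, mem_filter, mem_product, mem_range] at hn ⊢
        omega
    _ = ∑ p ∈ s, h p := sum_fiberwise_of_maps_to (fun p hp => by simp [s] at hp ⊢; omega) _
    _ ≤ ∑ p ∈ range M ×ˢ range M, h p :=
        sum_le_sum_of_subset_of_nonneg (filter_subset _ _) fun p _ _ => hh p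
    _ = truncNorm ρ M f * truncNorm ρ M g := by
        rw [sum_product, truncNorm, truncNorm, sum_mul_sum]

theorem truncNorm_C_le (a : ℂ) : truncNorm ρ M (C a) ≤ ‖a‖ := by
  cases M with
  | zero => simp [truncNorm]
  | succ M =>
    rw [truncNorm, sum_range_succ']
    simp [coeff_C]

/-- The factor `X` gains one index, which drives inductions on `M`, and a factor `ρ`, which makes
the bound close up for small radius. -/
theorem truncNorm_X_mul_succ : truncNorm ρ (M + 1) (X * f) = ρ * truncNorm ρ M f := by
  rw [truncNorm, sum_range_succ', truncNorm, mul_sum]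
  simp only [coeff_succ_X_mul, coeff_zero_X_mul, norm_zero, zero_mul, add_zero]
  exact sum_congr rfl fun _ _ => by ring

theorem truncNorm_mono_length (hρ : 0 ≤ ρ) {M' : ℕ} (h : M ≤ M') :
    truncNorm ρ M f ≤ truncNorm ρ M' f :=
  sum_le_sum_of_subset_of_nonneg (range_mono h) fun _ _ _ => by positivity

theorem truncNorm_mono_radius (hρ : 0 ≤ ρ) {ρ' : ℝ} (h : ρ ≤ ρ') :
    truncNorm ρ M f ≤ truncNorm ρ' M f :=
  sum_le_sum fun _ _ => by gcongr

theorem truncNorm_X_mul_le (hρ : 0 ≤ ρ) : truncNorm ρ M (X * f) ≤ ρ * truncNorm ρ M f :=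
  (truncNorm_mono_length hρ M.le_succ).trans_eq truncNorm_X_mul_succ

theorem truncNorm_pow_le (hρ : 0 ≤ ρ) {K : ℝ} (hK : truncNorm ρ M f ≤ K) (k : ℕ) :
    truncNorm ρ M (f ^ k) ≤ K ^ k := by
  induction k with
  | zero => simpa using truncNorm_C_le (M := M) 1
  | succ k ih =>
    rw [pow_succ, pow_succ]
    refine (truncNorm_mul_le hρ).trans ?_
    have h0 : 0 ≤ K := (truncNorm_nonneg hρ).trans hK
    exact mul_le_mul ih hK (truncNorm_nonneg hρ) (pow_nonneg h0 k)

theorem truncNorm_sum_le (hρ : 0 ≤ ρ) {ι : Type*} (s : Finset ι) (F : ι → ℂ⟦X⟧) :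
    truncNorm ρ M (∑ i ∈ s, F i) ≤ ∑ i ∈ s, truncNorm ρ M (F i) := by
  classical
  induction s using Finset.induction_on with
  | empty => simp [truncNorm]
  | insert i s hi ih =>
    rw [sum_insert hi, sum_insert hi]
    exact (truncNorm_add_le hρ).trans (by gcongr)

end TruncNorm

/-! ### Convergent and dominated series -/

/-- The power series whose truncated norms are bounded, for small radius, as long as those of `v`
are bounded by `K`. -/
noncomputable def dominated (v : ℂ⟦X⟧) (K : ℝ) : Subalgebra ℂ ℂ⟦X⟧ where
  carrier := {E | ∃ D ρ₀ : ℝ, 0 < ρ₀ ∧ ∀ ρ, 0 < ρ → ρ ≤ ρ₀ → ∀ M,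
    truncNorm ρ M v ≤ K → truncNorm ρ M E ≤ D}
  add_mem' := by
    rintro f g ⟨D, r, hr, h⟩ ⟨D', r', hr', h'⟩
    exact ⟨D + D', min r r', lt_min hr hr', fun ρ hρ hρ' M hM =>
      (truncNorm_add_le hρ.le).trans (add_le_add (h ρ hρ (hρ'.trans (min_le_left _ _)) M hM)
        (h' ρ hρ (hρ'.trans (min_le_right _ _)) M hM))⟩
  mul_mem' := by
    rintro f g ⟨D, r, hr, h⟩ ⟨D', r', hr', h'⟩
    refine ⟨D * D', min r r', lt_min hr hr', fun ρ hρ hρ' M hM => ?_⟩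
    have h1 := h ρ hρ (hρ'.trans (min_le_left _ _)) M hM
    exact (truncNorm_mul_le hρ.le).trans (mul_le_mul h1
      (h' ρ hρ (hρ'.trans (min_le_right _ _)) M hM) (truncNorm_nonneg hρ.le)
      ((truncNorm_nonneg hρ.le).trans h1))
  algebraMap_mem' a := ⟨‖a‖, 1, one_pos, fun ρ hρ _ M _ => truncNorm_C_le a⟩

/-- The algebra of convergent power series. -/
noncomputable def convergentSeries : Subalgebra ℂ ℂ⟦X⟧ := dominated 0 0

theorem mem_convergentSeries {f : ℂ⟦X⟧} :
    f ∈ convergentSeries ↔ ∃ D ρ : ℝ, 0 < ρ ∧ ∀ M, truncNorm ρ M f ≤ D := by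
  constructor
  · rintro ⟨D, ρ, hρ, h⟩
    exact ⟨D, ρ, hρ, fun M => h ρ hρ le_rfl M (by simp [truncNorm])⟩
  · rintro ⟨D, ρ, hρ, h⟩
    exact ⟨D, ρ, hρ, fun ρ' h0 h1 M _ => (truncNorm_mono_radius h0.le h1).trans (h M)⟩

theorem convergentSeries_le_dominated (v : ℂ⟦X⟧) (K : ℝ) :
    convergentSeries ≤ dominated v K := by
  intro f hf
  obtain ⟨D, ρ, hρ, h⟩ := mem_convergentSeries.mp hf
  exact ⟨D, ρ, hρ, fun ρ' h0 h1 M _ => (truncNorm_mono_radius h0.le h1).trans (h M)⟩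

theorem self_mem_dominated (v : ℂ⟦X⟧) (K : ℝ) : v ∈ dominated v K :=
  ⟨K, 1, one_pos, fun _ _ _ _ h => h⟩

theorem C_mem_convergentSeries (a : ℂ) : C a ∈ convergentSeries :=
  convergentSeries.algebraMap_mem a

theorem X_mem_convergentSeries : (X : ℂ⟦X⟧) ∈ convergentSeries := by
  refine mem_convergentSeries.mpr ⟨1, 1, one_pos, fun M => ?_⟩
  have := (truncNorm_X_mul_le (M := M) (f := C 1) zero_le_one).trans
    (mul_le_mul_of_nonneg_left (truncNorm_C_le 1) zero_le_one)
  simpa using this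

theorem mem_convergentSeries_of_X_mul {f : ℂ⟦X⟧} (h : X * f ∈ convergentSeries) :
    f ∈ convergentSeries := by
  obtain ⟨D, ρ, hρ, h⟩ := mem_convergentSeries.mp h
  refine mem_convergentSeries.mpr ⟨D / ρ, ρ, hρ, fun M => ?_⟩
  rw [le_div_iff₀' hρ, ← truncNorm_X_mul_succ]
  exact h _

theorem mem_convergentSeries_of_X_pow_mul {f : ℂ⟦X⟧} (k : ℕ) (h : X ^ k * f ∈ convergentSeries) :
    f ∈ convergentSeries := by
  induction k with
  | zero => simpa using h
  | succ k ih => exact ih (mem_convergentSeries_of_X_mul (by rwa [pow_succ', mul_assoc] at h))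

theorem exists_eq_C_add_X_mul (f : ℂ⟦X⟧) : ∃ g, f = C (constantCoeff f) + X * g := by
  obtain ⟨g, hg⟩ := X_dvd_iff.mpr (show constantCoeff (f - C (constantCoeff f)) = 0 by simp)
  exact ⟨g, by rw [← hg]; ring⟩

theorem exists_mem_eq_C_add_X_mul {f : ℂ⟦X⟧} (hf : f ∈ convergentSeries) :
    ∃ g ∈ convergentSeries, f = C (constantCoeff f) + X * g := by
  obtain ⟨g, hg⟩ := exists_eq_C_add_X_mul f
  refine ⟨g, mem_convergentSeries_of_X_mul ?_, hg⟩
  rw [← sub_eq_iff_eq_add'.mpr hg]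
  exact sub_mem hf (C_mem_convergentSeries _)

/-- If `v = v₀ + X E` and `E` is dominated by `v`, then `v` converges. -/
theorem mem_convergentSeries_of_dominated {v E : ℂ⟦X⟧} {a : ℂ} (h : v = C a + X * E)
    (hE : E ∈ dominated v (‖constantCoeff v‖ + 1)) : v ∈ convergentSeries := by
  obtain rfl : a = constantCoeff v := by rw [h]; simp
  set a := constantCoeff v
  obtain ⟨D, r, hr, hD⟩ := hE
  have hD0 : 0 < |D| + 1 := by positivity
  -- With `ρ * |D| ≤ 1`, a bound on `v` up to `M` bounds `E` up to `M`, hence `X * E` by `1` up to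
  -- `M + 1`.
  let ρ := min r (|D| + 1)⁻¹
  have hρ : 0 < ρ := lt_min hr (inv_pos.mpr hD0)
  refine mem_convergentSeries.mpr ⟨‖a‖ + 1, ρ, hρ, fun M => ?_⟩
  induction M with
  | zero => simp [truncNorm]; positivity
  | succ M ih =>
    rw [h]
    refine (truncNorm_add_le hρ.le).trans (add_le_add (truncNorm_C_le _) ?_)
    rw [truncNorm_X_mul_succ]
    calc ρ * truncNorm ρ M E ≤ (|D| + 1)⁻¹ * (|D| + 1) := by
          refine mul_le_mul (min_le_right _ _) ?_ (truncNorm_nonneg hρ.le) (by positivity)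
          exact (hD ρ hρ (min_le_left _ _) M ih).trans ((le_abs_self D).trans (by linarith))
      _ = 1 := inv_mul_cancel₀ hD0.ne'

/-! ### Algebraic power series -/

/-- A power series that is algebraic over the convergent power series converges. -/
theorem mem_convergentSeries_of_isAlgebraic {w : ℂ⟦X⟧} (hw : IsAlgebraic convergentSeries w) :
    w ∈ convergentSeries := by
  classical
  have hex : ∃ d, ∃ p : Polynomial convergentSeries, p ≠ 0 ∧ Polynomial.aeval w p = 0 ∧
      p.natDegree = d := by
    obtain ⟨p, hp, h⟩ := hw
    exact ⟨_, p, hp, h, rfl⟩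
  obtain ⟨p, hp, hpw, hdeg⟩ := Nat.find_spec hex
  -- Minimality of the degree and characteristic zero make `w` a simple root.
  have hder : Polynomial.aeval w p.derivative ≠ 0 := by
    intro h0
    by_cases hd : p.natDegree = 0
    · obtain ⟨c, rfl⟩ := Polynomial.natDegree_eq_zero.mp hd
      rw [Polynomial.aeval_C] at hpw
      exact hp (by rw [(FaithfulSMul.algebraMap_injective _ _ (hpw.trans (map_zero _).symm) :),
        Polynomial.C_0])
    · have hlt := Polynomial.natDegree_derivative_lt hd
      refine Nat.find_min hex (hdeg ▸ hlt) ⟨_, fun h => hd ?_, h0, rfl⟩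
      have : IsAddTorsionFree convergentSeries := ⟨fun n hn a b h => by
        have hn' : (n : ℂ) ≠ 0 := Nat.cast_ne_zero.mpr hn
        simp only [← Nat.cast_smul_eq_nsmul ℂ] at h
        exact smul_right_injective _ hn' h⟩
      exact Polynomial.derivative_eq_zero.mp h
  obtain ⟨e, g, hg, hg0⟩ : ∃ e g, Polynomial.aeval w p.derivative = X ^ e * g ∧
      constantCoeff g ≠ 0 :=
    ⟨_, _, (X_pow_order_mul_divXPowOrder).symm, by
      rwa [Ne, constantCoeff_divXPowOrder_eq_zero_iff]⟩
  -- Cutting at `e + 1` keeps the order of `p'(w₀)` equal to `e`, while the quadratic Taylor term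
  -- gets order at least `2e + 2`, beyond the `2e + 1` of the linear coefficient.
  obtain ⟨v, w₀, hw₀, hwv⟩ : ∃ v : ℂ⟦X⟧, ∃ w₀ ∈ convergentSeries, w = w₀ + X ^ (e + 1) * v := by
    refine ⟨_, _, ?_, (eq_X_pow_mul_shift_add_trunc (e + 1) w).trans (add_comm _ _)⟩
    rw [← Polynomial.coeToPowerSeries.ringHom_apply,
      Polynomial.as_sum_range_C_mul_X_pow (trunc (e + 1) w), map_sum]
    refine sum_mem fun i _ => ?_
    rw [Polynomial.coeToPowerSeries.ringHom_apply, Polynomial.coe_mul, Polynomial.coe_C,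
      Polynomial.coe_pow, Polynomial.coe_X]
    exact mul_mem (C_mem_convergentSeries _) (pow_mem X_mem_convergentSeries _)
  let A := dominated v (‖constantCoeff v‖ + 1)
  have hBA : convergentSeries ≤ A := convergentSeries_le_dominated _ _
  have hvA : v ∈ A := self_mem_dominated _ _
  have hXA : X ∈ A := hBA X_mem_convergentSeries
  have heval (q : Polynomial convergentSeries) (a : A) :
      A.val ((q.map (Subalgebra.inclusion hBA).toRingHom).eval a) =
        Polynomial.aeval (a : ℂ⟦X⟧) q := by
    rw [Polynomial.eval_map, Polynomial.aeval_def]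
    exact Polynomial.hom_eval₂ q _ A.val.toRingHom a
  -- Expanding inside `A` shows that the Taylor remainder `k`, which depends on `v`, is dominated
  -- too.
  obtain ⟨⟨k, hkA⟩, hk⟩ := (p.map (Subalgebra.inclusion hBA).toRingHom).binomExpansion
    ⟨w₀, hBA hw₀⟩ ⟨X ^ (e + 1) * v, mul_mem (pow_mem hXA _) hvA⟩
  replace hk := congrArg A.val hk
  simp only [Polynomial.derivative_map, map_add, map_mul, map_pow, heval, Subalgebra.coe_add,
    Subalgebra.coe_val, ← hwv, hpw] at hk
  have hmem (q : Polynomial convergentSeries) : Polynomial.aeval w₀ q ∈ convergentSeries := by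
    have := Polynomial.aeval_algebraMap_apply ℂ⟦X⟧ (⟨w₀, hw₀⟩ : convergentSeries) q
    exact (show Polynomial.aeval w₀ q = _ from this) ▸ Subtype.prop _
  obtain ⟨b, hb, hb0⟩ : ∃ b, Polynomial.aeval w₀ p.derivative = X ^ e * b ∧
      constantCoeff b ≠ 0 := by
    have hdvd := Polynomial.sub_dvd_eval_sub w w₀ (p.derivative.map (algebraMap _ ℂ⟦X⟧))
    rw [Polynomial.eval_map_algebraMap, Polynomial.eval_map_algebraMap, hg] at hdvd
    obtain ⟨l, hl⟩ := hdvd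
    refine ⟨g - X * v * l, ?_, by simpa using hg0⟩
    linear_combination -hl - l * hwv
  have hbB : b ∈ convergentSeries := mem_convergentSeries_of_X_pow_mul e (hb ▸ hmem _)
  -- This is `-p(w₀)` divided by `X ^ (2e + 1)`.
  have haB : b * v + X * (k * v ^ 2) ∈ convergentSeries := by
    refine mem_convergentSeries_of_X_pow_mul (e + 1 + e) ?_
    convert neg_mem (hmem p) using 1
    rw [hb] at hk
    linear_combination -hk
  obtain ⟨b₁, hb₁, hbb⟩ := exists_mem_eq_C_add_X_mul hbB
  obtain ⟨a₁, ha₁, haa⟩ := exists_mem_eq_C_add_X_mul haB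
  have hv : v ∈ convergentSeries := by
    refine mem_convergentSeries_of_dominated
      (a := (constantCoeff b)⁻¹ * constantCoeff (b * v + X * (k * v ^ 2)))
      (E := C (constantCoeff b)⁻¹ * (a₁ - b₁ * v - k * v ^ 2)) ?_ ?_
    · have hCC : C (constantCoeff b)⁻¹ * C (constantCoeff b) = (1 : ℂ⟦X⟧) := by
        rw [← map_mul, inv_mul_cancel₀ hb0, map_one]
      rw [map_mul]
      linear_combination C (constantCoeff b)⁻¹ * haa - C (constantCoeff b)⁻¹ * v * hbb - v * hCC
    · exact mul_mem (A.algebraMap_mem _) (sub_mem (sub_mem (hBA ha₁) (mul_mem (hBA hb₁) hvA))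
        (mul_mem hkA (pow_mem hvA 2)))
  rw [hwv]
  exact add_mem hw₀ (mul_mem (pow_mem X_mem_convergentSeries _) hv)

/-! ### Inverses, substitution and roots -/

theorem inv_mem_convergentSeries {f : ℂ⟦X⟧} (hf : f ∈ convergentSeries)
    (h0 : constantCoeff f ≠ 0) : f⁻¹ ∈ convergentSeries := by
  refine mem_convergentSeries_of_isAlgebraic
    ⟨Polynomial.C ⟨f, hf⟩ * Polynomial.X - 1, fun h => ?_, ?_⟩
  · simpa using congrArg (Polynomial.coeff · 0) h
  · simp only [map_sub, map_mul, Polynomial.aeval_C, Polynomial.aeval_X, map_one]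
    exact sub_eq_zero.mpr (PowerSeries.mul_inv_cancel f h0)

/-- Modulo `X ^ M` only the first `M` terms of `V` matter, and if `U` has norm at most `K`, then `X
* U` has norm at most `ρ * K`, within the radius of `V` for small `ρ`. -/
theorem subst_mem_dominated {V U : ℂ⟦X⟧} (hV : V ∈ convergentSeries) (K : ℝ) :
    V.subst (X * U) ∈ dominated U K := by
  obtain ⟨D, r, hr, hD⟩ := mem_convergentSeries.mp hV
  have hS : HasSubst (X * U) := HasSubst.of_constantCoeff_zero' (by simp)
  refine ⟨D, r / (|K| + 1), by positivity, fun ρ hρ hρr M hM => ?_⟩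
  have hXU : truncNorm ρ M (X * U) ≤ r := by
    refine (truncNorm_X_mul_le hρ.le).trans ?_
    rw [le_div_iff₀ (by positivity)] at hρr
    exact (mul_le_mul_of_nonneg_left (hM.trans ((le_abs_self K).trans (by linarith)))
      hρ.le).trans hρr
  have heq : truncNorm ρ M (V.subst (X * U)) =
      truncNorm ρ M (∑ d ∈ range M, C (coeff d V) * (X * U) ^ d) := by
    refine sum_congr rfl fun n hn => ?_
    congr 2
    rw [coeff_subst' hS, finsum_eq_sum_of_support_subset (s := range M), map_sum]
    · exact sum_congr rfl fun d _ => by rw [coeff_C_mul, smul_eq_mul]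
    · intro d hd
      by_contra hdM
      simp only [coe_range, Set.mem_Iio, not_lt] at hdM
      refine hd ?_
      change _ • _ = _
      rw [mul_pow, coeff_X_pow_mul', if_neg (by simp at hn; omega), smul_zero]
  rw [heq]
  refine (truncNorm_sum_le hρ.le _ _).trans (le_trans (sum_le_sum fun d _ => ?_) (hD M))
  refine (truncNorm_mul_le hρ.le).trans ?_
  exact mul_le_mul (truncNorm_C_le _) (truncNorm_pow_le hρ.le hXU d)
    (truncNorm_nonneg hρ.le) (norm_nonneg _)

/-- Compositional inverses of convergent series converge: here `X U` is inverse to `X V`. -/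
theorem mem_convergentSeries_of_mul_subst_eq_one {U V : ℂ⟦X⟧} (hV : V ∈ convergentSeries)
    (h : U * V.subst (X * U) = 1) : U ∈ convergentSeries := by
  have hS : HasSubst (X * U) := HasSubst.of_constantCoeff_zero' (by simp)
  obtain ⟨V₁, hV₁, hVV⟩ := exists_mem_eq_C_add_X_mul hV
  set b := constantCoeff V
  have hsub : V.subst (X * U) = C b + X * U * V₁.subst (X * U) := by
    rw [hVV, subst_add hS, subst_mul hS, subst_X hS]
    congr 1
    exact subst_C b
  rw [hsub] at h
  have hb : b ≠ 0 := by
    rintro hb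
    simpa [hb] using congrArg constantCoeff h
  -- Solve `U * (b + X * U * V₁(X * U)) = 1` for the `U` multiplying `b`.
  refine mem_convergentSeries_of_dominated (a := b⁻¹)
    (E := C (-b⁻¹) * (U * U * V₁.subst (X * U))) ?_ ?_
  · have : C b⁻¹ * C b = (1 : ℂ⟦X⟧) := by rw [← map_mul, inv_mul_cancel₀ hb, map_one]
    rw [map_neg]
    linear_combination C b⁻¹ * h - U * this
  · exact mul_mem ((dominated _ _).algebraMap_mem _) (mul_mem (mul_mem (self_mem_dominated _ _)
      (self_mem_dominated _ _)) (subst_mem_dominated hV₁ _))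

/-- Substitute `g / g(0) - 1` into the binomial series of `(1 + X) ^ (1 / m)`, and scale by an
`m`-th root of `g(0)`. -/
theorem exists_pow_eq_of_constantCoeff_ne_zero {g : ℂ⟦X⟧} (h0 : constantCoeff g ≠ 0) {m : ℕ}
    (hm : m ≠ 0) : ∃ U : ℂ⟦X⟧, U ^ m = g := by
  obtain ⟨a, ha⟩ := IsAlgClosed.exists_pow_nat_eq (constantCoeff g) (Nat.pos_of_ne_zero hm)
  have hbin (r : ℚ) (k : ℕ) : PowerSeries.binomialSeries ℂ (k * r) = PowerSeries.binomialSeries ℂ r ^ k := by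
    induction k with
    | zero => simp
    | succ k ih => rw [pow_succ, ← ih, ← binomialSeries_add]; congr 1; push_cast; ring
  have hroot : PowerSeries.binomialSeries ℂ (m : ℚ)⁻¹ ^ m = 1 + X := by
    rw [← hbin, mul_inv_cancel₀ (Nat.cast_ne_zero.mpr hm)]
    simpa using binomialSeries_nat (R := ℚ) (A := ℂ) 1
  have hh : HasSubst (C (constantCoeff g)⁻¹ * g - 1) :=
    HasSubst.of_constantCoeff_zero' (by simp [h0])
  refine ⟨C a * (PowerSeries.binomialSeries ℂ (m : ℚ)⁻¹).subst (C (constantCoeff g)⁻¹ * g - 1), ?_⟩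
  have hone : (1 : ℂ⟦X⟧).subst (C (constantCoeff g)⁻¹ * g - 1) = (1 : ℂ⟦X⟧) := by
    rw [← coe_substAlgHom hh, map_one]
  rw [mul_pow, ← subst_pow hh, hroot, subst_add hh, subst_X hh, hone, ← map_pow, ha,
    add_sub_cancel, ← mul_assoc, ← map_mul, mul_inv_cancel₀ h0, map_one, one_mul]

theorem subst_X_mul_bijective {U : ℂ⟦X⟧} (hU : constantCoeff U ≠ 0) :
    Function.Bijective fun g : ℂ⟦X⟧ => PowerSeries.subst (X * U) g := by
  have h0 : constantCoeff (X * U) = 0 := by simp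
  have h1 : IsUnit (coeff 1 (X * U)) := by
    rw [show (1 : ℕ) = 0 + 1 from rfl, coeff_succ_X_mul]
    simpa using hU
  have hS : HasSubst (X * U) := HasSubst.of_constantCoeff_zero' h0
  have hT := HasSubst.substInvOfIsUnit (X * U) h1
  refine Function.bijective_iff_has_inverse.mpr
    ⟨fun g => PowerSeries.subst ((X * U).substInvOfIsUnit h1) g, fun g => ?_, fun g => ?_⟩
  · change PowerSeries.subst _ (PowerSeries.subst _ g) = g
    rw [subst_comp_subst_apply hS hT, subst_substInvOfIsUnit_right _ h0, X_subst]
  · change PowerSeries.subst _ (PowerSeries.subst _ g) = g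
    rw [subst_comp_subst_apply hT hS, subst_substInvOfIsUnit_left _ h0, X_subst]

/-! ### The Euler derivation on Laurent series -/

/-- Mathlib has two structures of a `ℂ`-algebra on `LaurentSeries ℂ` that agree only
propositionally; this one makes scalars act coefficientwise. -/
noncomputable instance laurentSeriesAlgebra : Algebra ℂ (LaurentSeries ℂ) :=
  HahnSeries.instAlgebra

/-- The operator `X d/dX` on Laurent series. -/
noncomputable def eulerOperator : LaurentSeries ℂ →ₗ[ℂ] LaurentSeries ℂ where
  toFun f :=
    { coeff := fun j => (j : ℂ) * f.coeff j
      isPWO_support' := f.isPWO_support.mono fun _ hj => right_ne_zero_of_mul hj }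
  map_add' f g := by ext j; exact mul_add _ _ _
  map_smul' a f := by ext j; exact mul_left_comm _ _ _

theorem coeff_eulerOperator (f : LaurentSeries ℂ) (j : ℤ) :
    (eulerOperator f).coeff j = (j : ℂ) * f.coeff j := rfl

theorem support_eulerOperator_subset (f : LaurentSeries ℂ) :
    (eulerOperator f).support ⊆ f.support := fun _ hj => right_ne_zero_of_mul hj

/-- The derivation `X d/dX` of the field of Laurent series. -/
noncomputable def eulerDerivation : Derivation ℂ (LaurentSeries ℂ) (LaurentSeries ℂ) :=
  Derivation.mk' eulerOperator fun f g => by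
    ext j
    rw [smul_eq_mul, smul_eq_mul, mul_comm g, HahnSeries.coeff_add, coeff_eulerOperator,
      HahnSeries.coeff_mul, mul_sum,
      HahnSeries.coeff_mul_right' g.isPWO_support (support_eulerOperator_subset g),
      HahnSeries.coeff_mul_left' f.isPWO_support (support_eulerOperator_subset f),
      ← sum_add_distrib]
    refine sum_congr rfl fun p hp => ?_
    rw [coeff_eulerOperator, coeff_eulerOperator, ← (Finset.mem_antidiagonal.mp hp).2.2]
    push_cast
    ring

theorem coeff_eulerDerivation (f : LaurentSeries ℂ) (j : ℤ) :
    (eulerDerivation f).coeff j = (j : ℂ) * f.coeff j := rfl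

theorem eulerDerivation_ofPowerSeries (g : ℂ⟦X⟧) :
    eulerDerivation (HahnSeries.ofPowerSeries ℤ ℂ g) =
      HahnSeries.ofPowerSeries ℤ ℂ (X * d⁄dX ℂ g) := by
  ext j
  rw [coeff_eulerDerivation, coeff_coe, coeff_coe]
  split_ifs with hj
  · simp
  · obtain ⟨k, rfl⟩ := Int.eq_ofNat_of_zero_le (not_lt.mp hj)
    cases k with
    | zero => simp
    | succ k =>
      simp only [Int.natAbs_natCast, coeff_succ_X_mul, coeff_derivative]
      push_cast
      ring

theorem eulerDerivation_single (N : ℤ) (a : ℂ) :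
    eulerDerivation (HahnSeries.single N a) = (N : ℂ) • HahnSeries.single N a := by
  ext j
  rw [coeff_eulerDerivation, HahnSeries.coeff_smul, HahnSeries.coeff_single]
  split_ifs with h <;> simp [h]

theorem eq_C_of_eulerDerivation_eq_zero {f : LaurentSeries ℂ} (h : eulerDerivation f = 0) :
    f = HahnSeries.C (f.coeff 0) := by
  ext j
  rcases eq_or_ne j 0 with rfl | hj
  · simp
  · have := congrArg (HahnSeries.coeff · j) h
    simp only [coeff_eulerDerivation, HahnSeries.coeff_zero, mul_eq_zero, Int.cast_eq_zero, hj,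
      false_or] at this
    rw [this, HahnSeries.C_apply, HahnSeries.coeff_single_of_ne hj]

-- Integer powers and uniformizers

local notation "ι" => HahnSeries.ofPowerSeries ℤ ℂ

theorem ofPowerSeries_inv {g : ℂ⟦X⟧} (h0 : constantCoeff g ≠ 0) : ι g⁻¹ = (ι g)⁻¹ :=
  eq_inv_of_mul_eq_one_left (by rw [← map_mul, PowerSeries.inv_mul_cancel g h0, map_one])

theorem constantCoeff_ne_zero_of_pow {U : ℂ⟦X⟧} {k : ℕ} (hk : k ≠ 0)
    (h : constantCoeff (U ^ k) ≠ 0) : constantCoeff U ≠ 0 := by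
  rw [map_pow] at h
  exact (pow_ne_zero_iff hk).mp h

/-- The map `τ` is arbitrary because the power is needed both under `ι` and under `ι` composed with
the substitution `X ↦ X * U`. The converse holds as a root of a convergent series is algebraic. -/
theorem exists_ofPowerSeries_eq_zpow {g : ℂ⟦X⟧} (h0 : constantCoeff g ≠ 0) (N : ℤ) :
    ∃ h : ℂ⟦X⟧, (∀ τ : ℂ⟦X⟧ →+* LaurentSeries ℂ, τ h = τ g ^ N) ∧ (g ∈ convergentSeries → h ∈ convergentSeries) ∧
      (N ≠ 0 → h ∈ convergentSeries → g ∈ convergentSeries) := by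
  have hroot {u : ℂ⟦X⟧} {k : ℕ} (hk : k ≠ 0) (h : u ^ k ∈ convergentSeries) :
      u ∈ convergentSeries :=
    mem_convergentSeries_of_isAlgebraic (IsAlgebraic.of_pow (Nat.pos_of_ne_zero hk)
      (isAlgebraic_algebraMap (⟨u ^ k, h⟩ : convergentSeries)))
  obtain ⟨k, rfl | rfl⟩ := N.eq_nat_or_neg
  · exact ⟨g ^ k, by simp, fun h => pow_mem h k, fun hk h => hroot (by simpa using hk) h⟩
  · refine ⟨g⁻¹ ^ k, ?_, fun h => pow_mem (inv_mem_convergentSeries h h0) k, fun hk h => ?_⟩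
    · intro τ
      have hτ : τ g⁻¹ = (τ g)⁻¹ := eq_inv_of_mul_eq_one_left
        (by rw [← map_mul, PowerSeries.inv_mul_cancel g h0, map_one])
      rw [map_pow, hτ, zpow_neg, zpow_natCast, inv_pow]
    · have hinv := inv_mem_convergentSeries (hroot (by simpa using hk) h) (by simpa using h0)
      have : g⁻¹⁻¹ = g := by
        rw [PowerSeries.inv_eq_iff_mul_eq_one (by simpa using h0), PowerSeries.mul_inv_cancel g h0]
      rwa [this] at hinv

theorem exists_ofPowerSeries_zpow_eq {g : ℂ⟦X⟧} (h0 : constantCoeff g ≠ 0) {m : ℤ} (hm : m ≠ 0) :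
    ∃ U : ℂ⟦X⟧, constantCoeff U ≠ 0 ∧ ι U ^ m = ι g := by
  obtain ⟨k, rfl | rfl⟩ := m.eq_nat_or_neg
  · obtain ⟨U, rfl⟩ := exists_pow_eq_of_constantCoeff_ne_zero h0 (m := k) (by simpa using hm)
    exact ⟨U, constantCoeff_ne_zero_of_pow (by simpa using hm) h0, by simp⟩
  · have hi : constantCoeff g⁻¹ ≠ 0 := by simpa using h0
    have hk : k ≠ 0 := by simpa using hm
    obtain ⟨U, hU⟩ := exists_pow_eq_of_constantCoeff_ne_zero hi hk
    refine ⟨U, constantCoeff_ne_zero_of_pow hk (hU ▸ hi), ?_⟩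
    rw [zpow_neg, zpow_natCast, ← map_pow, hU, ofPowerSeries_inv h0, inv_inv]

theorem ofPowerSeries_X_mul_zpow (U : ℂ⟦X⟧) (m : ℤ) :
    ι (X * U) ^ m = HahnSeries.single m 1 * ι U ^ m := by
  rw [map_mul, mul_zpow, RatFunc.single_zpow, HahnSeries.ofPowerSeries_X]

/-- A nonconstant Laurent series is `c + S ^ m` for a uniformizer `S` and some `m ≠ 0`. -/
theorem exists_eq_C_add_zpow {f : LaurentSeries ℂ} (hf : f ≠ HahnSeries.C (f.coeff 0)) :
    ∃ (c : ℂ) (m : ℤ) (U : ℂ⟦X⟧), m ≠ 0 ∧ constantCoeff U ≠ 0 ∧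
      f = HahnSeries.C c + ι (X * U) ^ m := by
  obtain ⟨c, z, hz, hz0, hord⟩ : ∃ (c : ℂ) (z : LaurentSeries ℂ),
      f = HahnSeries.C c + z ∧ z ≠ 0 ∧ z.order ≠ 0 := by
    -- At a pole take `c = 0`; otherwise removing the constant term rules out order zero.
    by_cases h : f.order < 0
    · exact ⟨0, f, by simp, by rintro rfl; simp at h, h.ne⟩
    · refine ⟨f.coeff 0, f - HahnSeries.C (f.coeff 0), by simp, sub_ne_zero.mpr hf, fun h0 => ?_⟩
      have := HahnSeries.coeff_order_eq_zero.not.mpr (sub_ne_zero.mpr hf)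
      rw [h0] at this
      simp at this
  have hpart : constantCoeff z.powerSeriesPart ≠ 0 := by
    rw [← coeff_zero_eq_constantCoeff_apply, LaurentSeries.powerSeriesPart_coeff]
    simpa using HahnSeries.coeff_order_eq_zero.not.mpr hz0
  obtain ⟨U, hU, hUz⟩ := exists_ofPowerSeries_zpow_eq hpart hord
  refine ⟨c, z.order, U, hord, hU, ?_⟩
  rw [ofPowerSeries_X_mul_zpow, hUz, LaurentSeries.single_order_mul_powerSeriesPart, hz]

/-- The operator multiplies the `j`-th coefficient by the integer `N + j`, of modulus at least `1`
unless it vanishes. -/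
theorem mem_convergentSeries_of_euler {u : ℂ⟦X⟧} (N : ℤ)
    (h : C (N : ℂ) * u + X * d⁄dX ℂ u ∈ convergentSeries) : u ∈ convergentSeries := by
  have hcoeff (j : ℕ) : coeff j (C (N : ℂ) * u + X * d⁄dX ℂ u) = ((N + j : ℤ) : ℂ) * coeff j u := by
    rw [map_add, coeff_C_mul]
    cases j with
    | zero => simp
    | succ j => rw [coeff_succ_X_mul, coeff_derivative]; push_cast; ring
  -- The only index where `N + j` can vanish; for `N > 0` it is `0`, and dropping that term is
  -- harmless.
  set k := (-N).toNat
  suffices hu : u - C (coeff k u) * X ^ k ∈ convergentSeries by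
    rw [← sub_add_cancel u (C (coeff k u) * X ^ k)]
    exact add_mem hu (mul_mem (C_mem_convergentSeries _) (pow_mem X_mem_convergentSeries _))
  obtain ⟨D, ρ, hρ, hD⟩ := mem_convergentSeries.mp h
  refine mem_convergentSeries.mpr ⟨D, ρ, hρ, fun M => le_trans (sum_le_sum fun j _ => ?_) (hD M)⟩
  gcongr
  rw [hcoeff, map_sub, coeff_C_mul, coeff_X_pow, norm_mul]
  split_ifs with hj
  · subst hj
    simp
    positivity
  · have hN : N + j ≠ 0 := by omega
    have h1 : (1 : ℝ) ≤ ‖((N + j : ℤ) : ℂ)‖ := by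
      rw [Complex.norm_intCast]
      exact_mod_cast Int.one_le_abs hN
    rw [mul_zero, sub_zero]
    exact le_mul_of_one_le_left (norm_nonneg _) h1

/-! ### Convergence of Laurent solutions -/

/-- A Laurent series that is a power of `X` times a convergent power series. -/
def IsConvergentLaurent (f : LaurentSeries ℂ) : Prop :=
  ∃ k : ℤ, ∃ g ∈ convergentSeries, f = HahnSeries.single k 1 * ι g

theorem isConvergentLaurent_C (c : ℂ) : IsConvergentLaurent (HahnSeries.C c) :=
  ⟨0, C c, C_mem_convergentSeries c, by
    rw [HahnSeries.ofPowerSeries_C]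
    exact (one_mul _).symm⟩

theorem IsConvergentLaurent.C_add {f : LaurentSeries ℂ} (hf : IsConvergentLaurent f) (c : ℂ) :
    IsConvergentLaurent (HahnSeries.C c + f) := by
  obtain ⟨k, g, hg, rfl⟩ := hf
  have hX (n : ℕ) : ι (X ^ n) = HahnSeries.single (n : ℤ) 1 := by
    rw [HahnSeries.ofPowerSeries_X_pow]
  obtain ⟨n, rfl | rfl⟩ := k.eq_nat_or_neg
  · refine ⟨0, C c + X ^ n * g, add_mem (C_mem_convergentSeries c)
      (mul_mem (pow_mem X_mem_convergentSeries _) hg), ?_⟩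
    rw [map_add, map_mul, hX, HahnSeries.ofPowerSeries_C]
    exact (one_mul _).symm
  · refine ⟨-n, C c * X ^ n + g, add_mem (mul_mem (C_mem_convergentSeries c)
      (pow_mem X_mem_convergentSeries _)) hg, ?_⟩
    rw [map_add, map_mul, hX, HahnSeries.ofPowerSeries_C, mul_add, mul_left_comm,
      HahnSeries.single_mul_single]
    simp

/-- Since `ℂ` is algebraically closed, `f` is transcendental, so the dependence must involve `p`. -/
theorem isAlgebraic_adjoin_of_not_algebraicIndependent {L : Type*} [Field L] [Algebra ℂ L]
    {f p : L} (h : ¬ AlgebraicIndependent ℂ ![f, p]) (hf : f ∉ (algebraMap ℂ L).range) :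
    IsAlgebraic (Algebra.adjoin ℂ {f}) p := by
  by_contra hp
  have hft : AlgebraicIndependent ℂ ![f] := by
    rw [algebraicIndependent_iff_transcendental]
    intro halg
    exact hf (minpoly.mem_range_of_degree_eq_one ℂ f (IsAlgClosed.degree_eq_one_of_irreducible ℂ
      (minpoly.irreducible halg.isIntegral)))
  have hopt := (hft.option_iff_transcendental p).mpr (by
    rw [Matrix.range_cons, Matrix.range_empty, Set.union_empty]
    exact hp)
  refine h ?_
  have := hopt.comp (fun i : Fin 2 => ![some 0, none] i) (by decide)
  convert this using 1
  ext i
  fin_cases i <;> rfl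

theorem eulerDerivation_subst {U : ℂ⟦X⟧} (u : ℂ⟦X⟧) :
    eulerDerivation (ι (u.subst (X * U))) =
      ι ((d⁄dX ℂ u).subst (X * U)) * eulerDerivation (ι (X * U)) := by
  have hS : HasSubst (X * U) := HasSubst.of_constantCoeff_zero' (by simp)
  rw [eulerDerivation_ofPowerSeries, eulerDerivation_ofPowerSeries, derivative_subst hS, ← map_mul]
  congr 1
  ring

/-- A formal Laurent series `f` that is algebraically dependent on its derivative with respect to
`x = X ^ N` converges. -/
theorem isConvergentLaurent_of_not_algebraicIndependent {f : LaurentSeries ℂ} {N : ℤ} (hN : N ≠ 0)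
    (h : ¬ AlgebraicIndependent ℂ ![f, HahnSeries.single (-N) (N : ℂ)⁻¹ * eulerDerivation f]) :
    IsConvergentLaurent f := by
  by_cases hf : f = HahnSeries.C (f.coeff 0)
  · rw [hf]
    exact isConvergentLaurent_C _
  obtain ⟨c, m, U, hm, hU, hfS⟩ := exists_eq_C_add_zpow hf
  have hSub : HasSubst (X * U) := HasSubst.of_constantCoeff_zero' (by simp)
  obtain ⟨hinj, hsurj⟩ := subst_X_mul_bijective hU
  -- Inverting the coordinate change: `X = S * V(S)`.
  obtain ⟨V, hV⟩ := hsurj U⁻¹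
  change V.subst (X * U) = U⁻¹ at hV
  have hUV : U * V.subst (X * U) = 1 := by rw [hV, PowerSeries.mul_inv_cancel U hU]
  have hV0 : constantCoeff V ≠ 0 := by
    intro h0
    obtain ⟨V₁, rfl⟩ := X_dvd_iff.mpr h0
    rw [subst_mul hSub, subst_X hSub] at hUV
    simpa using congrArg constantCoeff hUV
  obtain ⟨u, huV, -, hVu⟩ := exists_ofPowerSeries_eq_zpow hV0 N
  let σ : ℂ⟦X⟧ →ₐ[ℂ] ℂ⟦X⟧ := substAlgHom hSub
  have hσ (g : ℂ⟦X⟧) : σ g = g.subst (X * U) := by rw [← coe_substAlgHom hSub]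
  have hσX : σ X = X * U := by rw [hσ, subst_X hSub]
  set S := ι (X * U) with hS
  have hS0 : S ≠ 0 := by
    intro h0
    have : X * U = 0 := HahnSeries.ofPowerSeries_injective (h0.trans (map_zero ι).symm)
    rcases mul_eq_zero.mp this with h1 | h1
    · exact X_ne_zero h1
    · exact hU (by rw [h1, map_zero])
  set W := C (N : ℂ) * u + X * d⁄dX ℂ u with hW
  have hx : HahnSeries.single N (1 : ℂ) = S ^ N * ι (σ u) := by
    have := huV ((ι : ℂ⟦X⟧ →+* LaurentSeries ℂ).comp σ.toRingHom)
    simp only [RingHom.comp_apply, AlgHom.toRingHom_eq_coe, RingHom.coe_coe] at this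
    rw [this, ← mul_zpow, hS, ← map_mul, hσ, mul_assoc, hUV, mul_one, HahnSeries.ofPowerSeries_X,
      RatFunc.single_zpow]
  -- Apply the Euler derivation to `x = S ^ N * u(S)`.
  have hδx : (N : LaurentSeries ℂ) * HahnSeries.single N 1 =
      S ^ (N - 1) * eulerDerivation S * ι (σ W) := by
    have hCN : ι (C (N : ℂ)) = (N : LaurentSeries ℂ) := by
      rw [map_intCast, map_intCast]
    have hσW : ι (σ W) = N * ι (σ u) + S * ι (σ (d⁄dX ℂ u)) := by
      have hσC : σ (C (N : ℂ)) = C (N : ℂ) := by rw [map_intCast, map_intCast]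
      rw [hW, map_add, map_mul, map_mul, hσX, hσC, map_add, map_mul, map_mul, hCN]
    have h1 := eulerDerivation_single N 1
    rw [← hCN, HahnSeries.ofPowerSeries_C, HahnSeries.C_mul_eq_smul, ← h1, hx,
      Derivation.leibniz, Derivation.leibniz_zpow, hσ u, eulerDerivation_subst, ← hσ, ← hσ, hσW]
    simp only [smul_eq_mul, zsmul_eq_mul]
    rw [← hS, show S ^ N = S ^ (N - 1) * S by rw [← zpow_add_one₀ hS0, sub_add_cancel]]
    ring
  set p := HahnSeries.single (-N) (N : ℂ)⁻¹ * eulerDerivation f with hp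
  have hδf : eulerDerivation f = m * S ^ (m - 1) * eulerDerivation S := by
    rw [hfS, map_add, Derivation.leibniz_zpow]
    have : eulerDerivation (HahnSeries.C c) = 0 := eulerDerivation.map_algebraMap c
    rw [this, zero_add, smul_eq_mul, zsmul_eq_mul, mul_assoc]
  have hδf0 : eulerDerivation f ≠ 0 := fun h0 => hf (eq_C_of_eulerDerivation_eq_zero h0)
  have hδS : eulerDerivation S ≠ 0 := fun h0 => hδf0 (by rw [hδf, h0, mul_zero])
  have hpx : p * (N * HahnSeries.single N (1 : ℂ)) = eulerDerivation f := by
    have hone : HahnSeries.single (-N) (N : ℂ)⁻¹ * (N * HahnSeries.single N (1 : ℂ)) =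
        (1 : LaurentSeries ℂ) := by
      have hCN : (N : LaurentSeries ℂ) = HahnSeries.C (N : ℂ) := by rw [map_intCast]
      rw [hCN, HahnSeries.C_apply, HahnSeries.single_mul_single, HahnSeries.single_mul_single,
        zero_add, neg_add_cancel, mul_one, inv_mul_cancel₀ (Int.cast_ne_zero.mpr hN)]
      rfl
    rw [hp, mul_right_comm, hone, one_mul]
  have hp0 : p ≠ 0 := fun h0 => hδf0 (by rw [← hpx, h0, zero_mul])
  -- In `p = δf / (N x)` the factor `δS` cancels, leaving only powers of `S` and `p`.
  have hσW : ι (σ W) = m * S ^ (m - 1) * (S ^ (N - 1))⁻¹ * p⁻¹ := by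
    have h1 : p * (S ^ (N - 1) * eulerDerivation S * ι (σ W)) =
        m * S ^ (m - 1) * eulerDerivation S := by rw [← hδx, hpx, hδf]
    have h2 : S ^ (N - 1) ≠ 0 := zpow_ne_zero _ hS0
    field_simp
    refine mul_right_cancel₀ hδS ?_
    linear_combination h1
  have hWmem : W ∈ convergentSeries := by
    let τ : ℂ⟦X⟧ →ₐ[ℂ] LaurentSeries ℂ :=
      { (ι : ℂ⟦X⟧ →+* LaurentSeries ℂ).comp σ.toRingHom with
        commutes' := fun a => by
          change ι (σ (algebraMap ℂ ℂ⟦X⟧ a)) = _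
          rw [AlgHom.commutes]
          exact HahnSeries.ofPowerSeries_C a }
    have hτ : Function.Injective τ := by
      intro a b hab
      have hab : σ a = σ b := HahnSeries.ofPowerSeries_injective hab
      rw [hσ, hσ] at hab
      exact hinj hab
    let R := Algebra.adjoin ℂ {S}
    have hSR : IsAlgebraic R S :=
      isAlgebraic_algebraMap (⟨S, Algebra.subset_adjoin rfl⟩ : R)
    have hz (k : ℤ) : IsAlgebraic R (S ^ k) := by
      obtain ⟨n, rfl | rfl⟩ := k.eq_nat_or_neg
      · simpa using hSR.pow n
      · simpa using (IsAlgebraic.inv_iff.mpr hSR).pow n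
    have hfR : IsAlgebraic R f := by
      rw [hfS]
      exact (isAlgebraic_algebraMap (algebraMap ℂ R c)).add (hz m)
    have hpR : IsAlgebraic R p := by
      refine IsAlgebraic.adjoin_of_forall_isAlgebraic (s := {f}) ?_
        (isAlgebraic_adjoin_of_not_algebraicIndependent h ?_)
      · rintro _ ⟨rfl, -⟩
        exact hfR
      · rintro ⟨a, ha⟩
        refine hδf0 ?_
        rw [← ha, Derivation.map_algebraMap]
    have hWR : IsAlgebraic R (τ W) := by
      change IsAlgebraic R (ι (σ W))
      rw [hσW]
      exact (((isAlgebraic_intCast m).mul (hz _)).mul (IsAlgebraic.inv_iff.mpr (hz _))).mul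
        (IsAlgebraic.inv_iff.mpr hpR)
    -- As `τ` sends `X` to `S`, algebraicity over `ℂ[S]` pulls back to algebraicity over the
    -- convergent series.
    have hle : R ≤ convergentSeries.map τ := by
      refine Algebra.adjoin_le ?_
      rintro _ rfl
      exact ⟨X, X_mem_convergentSeries, congrArg ι hσX⟩
    refine mem_convergentSeries_of_isAlgebraic (IsAlgebraic.of_ringHom_of_comp_eq
      (convergentSeries.equivMapOfInjective τ hτ) τ (hWR.tower_top_of_subalgebra_le hle)
      (convergentSeries.equivMapOfInjective τ hτ).surjective hτ rfl)
  have hUmem := mem_convergentSeries_of_mul_subst_eq_one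
    (hVu hN (mem_convergentSeries_of_euler N hWmem)) hUV
  obtain ⟨g, hg, hgU, -⟩ := exists_ofPowerSeries_eq_zpow hU m
  rw [hfS]
  refine IsConvergentLaurent.C_add ⟨m, g, hgU hUmem, ?_⟩ c
  rw [hg ι, ofPowerSeries_X_mul_zpow]

/-! ### Passage to Puiseux series -/

/-- Multiplication by `1 / n`, as a map from `ℤ` to `ℚ`. -/
def divHom (n : ℕ) : ℤ →+ ℚ where
  toFun j := j / n
  map_zero' := by simp
  map_add' i j := by push_cast; ring

theorem divHom_apply (n : ℕ) (j : ℤ) : divHom n j = j / n := rfl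

theorem divHom_le_divHom_iff {n : ℕ} (hn : 0 < n) (i j : ℤ) :
    divHom n i ≤ divHom n j ↔ i ≤ j := by
  rw [divHom_apply, divHom_apply, div_le_div_iff_of_pos_right (by exact_mod_cast hn)]
  exact_mod_cast Iff.rfl

theorem divHom_injective {n : ℕ} (hn : 0 < n) : Function.Injective (divHom n) := fun i j h =>
  le_antisymm ((divHom_le_divHom_iff hn i j).mp h.le) ((divHom_le_divHom_iff hn j i).mp h.ge)

/-- The substitution `X ↦ X ^ (1 / n)`, from Laurent series to Puiseux series. -/
noncomputable def toPuiseux {n : ℕ} (hn : 0 < n) : LaurentSeries ℂ →+* HahnSeries ℚ ℂ :=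
  HahnSeries.embDomainRingHom (divHom n) (divHom_injective hn) (divHom_le_divHom_iff hn)

section ToPuiseux

variable {n : ℕ} (hn : 0 < n)

theorem coeff_toPuiseux (f : LaurentSeries ℂ) (j : ℤ) :
    (toPuiseux hn f).coeff (j / n) = f.coeff j :=
  HahnSeries.embDomain_coeff (f := ⟨⟨divHom n, divHom_injective hn⟩, divHom_le_divHom_iff hn _ _⟩)

theorem coeff_toPuiseux_of_forall_ne (f : LaurentSeries ℂ) {q : ℚ} (hq : ∀ j : ℤ, q ≠ j / n) :
    (toPuiseux hn f).coeff q = 0 :=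
  HahnSeries.embDomain_of_notMem_range (by rintro ⟨j, rfl⟩; exact hq j rfl)

theorem toPuiseux_injective : Function.Injective (toPuiseux hn) :=
  HahnSeries.embDomain_injective

theorem eq_toPuiseux_iff {φ : HahnSeries ℚ ℂ} {f : LaurentSeries ℂ}
    (hφ : ∀ q : ℚ, φ.coeff q ≠ 0 → ∃ j : ℤ, q = j / n) :
    φ = toPuiseux hn f ↔ ∀ j : ℤ, φ.coeff (j / n) = f.coeff j := by
  refine ⟨fun h j => by rw [h, coeff_toPuiseux], fun h => ?_⟩
  ext q
  by_cases hq : ∃ j : ℤ, q = j / n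
  · obtain ⟨j, rfl⟩ := hq
    rw [h, coeff_toPuiseux]
  · rw [coeff_toPuiseux_of_forall_ne hn f (not_exists.mp hq)]
    exact not_not.mp fun h0 => hq (hφ q h0)

theorem exists_eq_toPuiseux {φ : HahnSeries ℚ ℂ}
    (hφ : ∀ q : ℚ, φ.coeff q ≠ 0 → ∃ j : ℤ, q = j / n) :
    ∃ f : LaurentSeries ℂ, φ = toPuiseux hn f := by
  let f : LaurentSeries ℂ :=
    { coeff := fun j => φ.coeff (j / n)
      isPWO_support' := fun g => by
        obtain ⟨a, b, hab, h⟩ := φ.isPWO_support fun i => ⟨divHom n (g i), (g i).2⟩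
        exact ⟨a, b, hab, (divHom_le_divHom_iff hn _ _).mp h⟩ }
  exact ⟨f, (eq_toPuiseux_iff hn hφ).mpr fun j => rfl⟩

/-- The operator is `d/dx` for `x = X ^ N`. -/
theorem coeff_derivation_pow (f : LaurentSeries ℂ) (N j : ℤ) :
    (HahnSeries.single (-N) (N : ℂ)⁻¹ * eulerDerivation f).coeff j =
      (N : ℂ)⁻¹ * ((j + N : ℤ) * f.coeff (j + N)) := by
  have := HahnSeries.coeff_single_mul_add (r := (N : ℂ)⁻¹) (x := eulerDerivation f)
    (a := j + N) (b := -N)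
  rwa [add_neg_cancel_right, coeff_eulerDerivation] at this

theorem derivFinite_toPuiseux (f : LaurentSeries ℂ) :
    derivFinite (toPuiseux hn f) =
      toPuiseux hn (HahnSeries.single (-(n : ℤ)) ((n : ℤ) : ℂ)⁻¹ * eulerDerivation f) := by
  have hn0 : (n : ℚ) ≠ 0 := by exact_mod_cast hn.ne'
  have hn1 : (n : ℂ) ≠ 0 := by exact_mod_cast hn.ne'
  rw [eq_toPuiseux_iff]
  · intro j
    have hj : (j / n + 1 : ℚ) = ((j + n : ℤ) : ℚ) / n := by push_cast; field_simp
    change (((j / n + 1 : ℚ)) : ℂ) * (toPuiseux hn f).coeff (j / n + 1) = _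
    rw [hj, coeff_toPuiseux, coeff_derivation_pow]
    push_cast
    ring
  · intro q hq
    have hq' : (toPuiseux hn f).coeff (q + 1) ≠ 0 := right_ne_zero_of_mul hq
    by_contra! h
    refine hq' (coeff_toPuiseux_of_forall_ne hn f fun j hj => h (j - n) ?_)
    rw [eq_sub_of_add_eq hj]
    push_cast
    field_simp

theorem derivInfinity_toPuiseux (f : LaurentSeries ℂ) :
    derivInfinity (toPuiseux hn f) =
      toPuiseux hn (HahnSeries.single (-(-n : ℤ)) ((-n : ℤ) : ℂ)⁻¹ * eulerDerivation f) := by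
  have hn0 : (n : ℚ) ≠ 0 := by exact_mod_cast hn.ne'
  have hn1 : (n : ℂ) ≠ 0 := by exact_mod_cast hn.ne'
  rw [eq_toPuiseux_iff]
  · intro j
    have hj : (j / n - 1 : ℚ) = ((j + -n : ℤ) : ℚ) / n := by push_cast; field_simp; ring
    change -(((j / n - 1 : ℚ)) : ℂ) * (toPuiseux hn f).coeff (j / n - 1) = _
    rw [hj, coeff_toPuiseux, coeff_derivation_pow]
    push_cast
    field_simp
  · intro q hq
    have hq' : (toPuiseux hn f).coeff (q - 1) ≠ 0 := right_ne_zero_of_mul hq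
    by_contra! h
    refine hq' (coeff_toPuiseux_of_forall_ne hn f fun j hj => h (j + n) ?_)
    rw [eq_add_of_sub_eq hj]
    push_cast
    field_simp

theorem not_algebraicIndependent_of_aeval_toPuiseux {F : MvPolynomial (Fin 2) ℂ} (hF : F ≠ 0)
    {f p : LaurentSeries ℂ}
    (h : MvPolynomial.aeval ![toPuiseux hn f, toPuiseux hn p] F = 0) :
    ¬ AlgebraicIndependent ℂ ![f, p] := by
  intro hind
  refine hF (algebraicIndependent_iff.mp hind F (toPuiseux_injective hn ?_))
  rw [map_zero, ← h, MvPolynomial.aeval_def, MvPolynomial.aeval_def, MvPolynomial.hom_eval₂]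
  congr 1
  -- On the Puiseux side, constants enter through power series.
  · ext1 a
    change toPuiseux hn (HahnSeries.C a) = HahnSeries.ofPowerSeries ℚ ℂ (C a)
    rw [HahnSeries.ofPowerSeries_C]
    exact HahnSeries.embDomainRingHom_C
  · ext1 i
    fin_cases i <;> rfl

/-- Only the moduli of `e` matter, so one statement serves every branch and both kinds of expansion
point. The radius is `ρ ^ n` because `X = x ^ (1 / n)`. -/
theorem IsConvergentLaurent.exists_summable {f : LaurentSeries ℂ} (hf : IsConvergentLaurent f) :
    ∃ r : ℝ, 0 < r ∧ ∀ (τ : ℝ) (e : ℚ → ℂ), 0 < τ → τ < r → (∀ q : ℚ, ‖e q‖ = τ ^ (q : ℝ)) →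
      Summable fun q : ℚ => (toPuiseux hn f).coeff q * e q := by
  obtain ⟨k, g, hg, rfl⟩ := hf
  obtain ⟨D, ρ, hρ, hD⟩ := mem_convergentSeries.mp hg
  have hsum : Summable fun j => ‖coeff j g‖ * ρ ^ j :=
    summable_of_sum_range_le (fun j => by positivity) hD
  refine ⟨ρ ^ n, by positivity, fun τ e hτ hτρ he => ?_⟩
  have hinj : Function.Injective fun j : ℕ => (((k + j : ℤ) : ℚ) / n) := fun i j hij => by
    have := divHom_injective hn (a₁ := k + i) (a₂ := k + j) hij
    omega
  refine (hinj.summable_iff fun q hq => ?_).mp ?_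
  · by_cases hj : ∃ j : ℤ, q = j / n
    · obtain ⟨j, rfl⟩ := hj
      have hjk : j - k < 0 := by
        by_contra! hjk
        refine hq ⟨(j - k).toNat, ?_⟩
        simp only [Int.toNat_of_nonneg hjk, add_sub_cancel]
      rw [coeff_toPuiseux, ← sub_add_cancel j k, HahnSeries.coeff_single_mul_add, coeff_coe,
        if_pos hjk, mul_zero, zero_mul]
    · rw [coeff_toPuiseux_of_forall_ne hn _ (not_exists.mp hj), zero_mul]
  · refine Summable.of_norm_bounded (hsum.mul_left (τ ^ ((k : ℝ) / n))) fun j => ?_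
    have hn1 : (n : ℝ) ≠ 0 := by exact_mod_cast hn.ne'
    have hpow : τ ^ ((j : ℝ) / n) ≤ ρ ^ j := by
      calc τ ^ ((j : ℝ) / n) ≤ (ρ ^ n) ^ ((j : ℝ) / n) := by gcongr
        _ = ρ ^ j := by
          rw [← Real.rpow_natCast, ← Real.rpow_mul hρ.le, mul_div_cancel₀ _ hn1,
            Real.rpow_natCast]
    have hexp : (((((k + j : ℤ) : ℚ) / n : ℚ)) : ℝ) = (k : ℝ) / n + (j : ℝ) / n := by
      push_cast
      ring
    rw [Function.comp_apply, norm_mul, coeff_toPuiseux, add_comm k,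
      HahnSeries.coeff_single_mul_add, coeff_coe, if_neg (by omega), one_mul, Int.natAbs_natCast,
      he, add_comm (j : ℤ), hexp, Real.rpow_add hτ]
    calc ‖coeff j g‖ * (τ ^ ((k : ℝ) / n) * τ ^ ((j : ℝ) / n))
        = τ ^ ((k : ℝ) / n) * (‖coeff j g‖ * τ ^ ((j : ℝ) / n)) := by ring
      _ ≤ _ := by gcongr

end ToPuiseux

theorem mainTheorem1 (F : MvPolynomial (Fin 2) ℂ) (hF : F ≠ 0)
    (φ : HahnSeries ℚ ℂ) (hφ : IsPuiseux φ) :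
    (IsFormalSolutionFinite F φ → ∀ x₀ : ℂ, ConvergesAt x₀ φ) ∧
      (IsFormalSolutionInfinity F φ → ConvergesAtInfinity φ) := by
  obtain ⟨n, hn, hφ⟩ := hφ
  obtain ⟨f, rfl⟩ := exists_eq_toPuiseux hn hφ
  constructor
  · intro h x₀
    rw [IsFormalSolutionFinite, derivFinite_toPuiseux] at h
    obtain ⟨r, hr, hs⟩ := (isConvergentLaurent_of_not_algebraicIndependent
      (by exact_mod_cast hn.ne') (not_algebraicIndependent_of_aeval_toPuiseux hn hF h)).exists_summable
        hn
    refine ⟨r, hr, fun x hx hxr => hs _ _ hx hxr fun q => ?_⟩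
    exact_mod_cast Complex.norm_cpow_real (x - x₀) q
  · intro h
    rw [IsFormalSolutionInfinity, derivInfinity_toPuiseux] at h
    obtain ⟨r, hr, hs⟩ := (isConvergentLaurent_of_not_algebraicIndependent
      (by simpa using hn.ne') (not_algebraicIndependent_of_aeval_toPuiseux hn hF h)).exists_summable
        hn
    -- The local parameter at infinity is `1 / x`.
    refine ⟨r⁻¹, inv_pos.mpr hr, fun x hx => hs ‖x‖⁻¹ _ ?_ ?_ fun q => ?_⟩
    · exact inv_pos.mpr ((inv_pos.mpr hr).trans hx)
    · exact inv_lt_of_inv_lt₀ hr hx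
    · rw [Real.inv_rpow (norm_nonneg _), ← Real.rpow_neg (norm_nonneg _)]
      exact_mod_cast Complex.norm_cpow_real x (-q)
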